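/- A semi-metric on a set $X$ is a symmetric function $d_X:X\times X\to[0,\infty)$ with $d_X(x,y)=0$ if and only if $x=y$ (no triangle inequality is required). For $r\ge 0$ the power $d_X^{r}$ is the semi-metric equal to $d_X(x,y)^r$ for $x\neq y$ and to $0$ for $x=y$ (so $0^0=0$ here). For $p\ge 0$, $(X,d_X)$ has *$p$-negative type* if $\sum_{i,j=1}^n d_X(x_i,x_j)^p\xi_i\xi_j\le 0$ for all $n\ge 2$, all distinct $x_1,\dots,x_n\in X$ and all real $\xi_1,\dots,\xi_n$ with $\sum_i\xi_i=0$; and $\wp_X=\sup\{p\ge 0: X\text{ has }p\text{-negative type}\}\in[0,\infty]$. Let $\mathcal O_n(\mathbb R)$ be the set of symmetric positive semidefinite real $n\times n$ matrices $Q$ with $Q\mathbb 1=0$, where $\mathbb 1=(1,\dots,1)^T$. For $p\ge 0$ and $1\le C<\infty$, $(X,d_X)$ has *$p$-negative type with distortion $C$* if $$\sum_{q_{ij}>0}d_X(x_i,x_j)^p q_{ij}+C^2\sum_{q_{ij}<0}d_X(x_i,x_j)^p q_{ij}\le 0$$ for all $n\ge 2$, all distinct $x_1,\dots,x_n\in X$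 and all $Q=(q_{ij})\in\mathcal O_n(\mathbb R)$; it has *strict* $p$-negative type with distortion $C$ if, moreover, equality holds only for $Q=0$. A map $f$ from a semi-metric space $(X,d_X)$ to a semi-metric space $(Y,d_Y)$ has distortion at most $C$ ($1\le C<\infty$) if there is $s>0$ with $s\,d_X(x,y)\le d_Y(f(x),f(y))\le sC\,d_X(x,y)$ for all $x,y\in X$; $\mathrm{dist}(f)\in[1,\infty]$ is the least such $C$ ($\infty$ if there is none). The Euclidean distortion $c_2(X,d_X)$ is the infimum of all $C\in[1,\infty]$ for which some map $f:X\to\ell^2$ has $\mathrm{dist}(f)\le C$. **Corollary 3.8 (Distorted Strict Characterisation).** Let $(X,d_X)$ be a finite semi-metric space, $0\le p<\infty$ and $1\le C<\infty$. Then $X$ has strict $p$-negative type with distortion $C$ if and only if $p<\wp_X$ or $C>c_2(X,d_X^{p/2})$. -/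

import Mathlib

open scoped Matrix

noncomputable section

/-- A (real-valued) semi-metric on `X`: a metric without the triangle inequality. -/
structure SemiMetric (X : Type*) where
  d : X → X → ℝ
  nonneg : ∀ x y, 0 ≤ d x y
  eq_zero_iff : ∀ x y, d x y = 0 ↔ x = y
  symm : ∀ x y, d x y = d y x

namespace SemiMetric

/-- The semi-metric underlying a metric space. -/
def ofMetric (Y : Type*) [MetricSpace Y] : SemiMetric Y where
  d := dist
  nonneg _ _ := dist_nonneg
  eq_zero_iff _ _ := dist_eq_zero
  symm := dist_comm

/-- The power `d ^ r` of a semi-metric, again a semi-metric. It vanishes on the diagonal for every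
exponent, so that `d ^ 0` is the discrete metric (that is, `0 ^ 0 = 0` here). -/
def pow {X : Type*} (D : SemiMetric X) (r : ℝ) : SemiMetric X where
  d x y := if D.d x y = 0 then 0 else D.d x y ^ r
  nonneg x y := by
    split_ifs
    · exact le_rfl
    · exact Real.rpow_nonneg (D.nonneg x y) r
  eq_zero_iff x y := by
    split_ifs with h
    · simpa using (D.eq_zero_iff x y).1 h
    · have hpos : 0 < D.d x y := lt_of_le_of_ne (D.nonneg x y) (Ne.symm h)
      have hne : x ≠ y := fun e => h ((D.eq_zero_iff x y).2 e)
      simp [hne, (Real.rpow_pos_of_pos hpos r).ne']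
  symm x y := by rw [D.symm x y]

/-- `p`-negative type. -/
def HasNegativeType {X : Type*} (D : SemiMetric X) (p : ℝ) : Prop :=
  ∀ n : ℕ, 2 ≤ n → ∀ x : Fin n → X, Function.Injective x →
    ∀ ξ : Fin n → ℝ, ∑ i, ξ i = 0 →
      ∑ i, ∑ j, (D.pow p).d (x i) (x j) * ξ i * ξ j ≤ 0

/-- The supremal `p`-negative type, an element of `[0, ∞]`. -/
def supremalNegativeType {X : Type*} (D : SemiMetric X) : EReal :=
  sSup ((fun p : ℝ => (p : EReal)) '' {p : ℝ | 0 ≤ p ∧ D.HasNegativeType p})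

/-- The real positive semidefinite matrices `Q` with `Q 𝟙 = 0`. -/
def nullPSD (n : ℕ) : Set (Matrix (Fin n) (Fin n) ℝ) :=
  {Q | Q.PosSemidef ∧ Q *ᵥ 1 = 0}

/-- `∑_{q_ij > 0} d(x_i, x_j)^p q_ij + C² ∑_{q_ij < 0} d(x_i, x_j)^p q_ij`. -/
def distortedSum {X : Type*} (D : SemiMetric X) (p C : ℝ) {n : ℕ} (x : Fin n → X)
    (Q : Matrix (Fin n) (Fin n) ℝ) : ℝ :=
  (∑ i, ∑ j, if 0 < Q i j then (D.pow p).d (x i) (x j) * Q i j else 0) +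
    C ^ 2 * ∑ i, ∑ j, if Q i j < 0 then (D.pow p).d (x i) (x j) * Q i j else 0

/-- `p`-negative type with distortion `C`. -/
def HasDistortedNegativeType {X : Type*} (D : SemiMetric X) (p C : ℝ) : Prop :=
  ∀ n : ℕ, 2 ≤ n → ∀ x : Fin n → X, Function.Injective x →
    ∀ Q ∈ nullPSD n, D.distortedSum p C x Q ≤ 0

/-- Strict `p`-negative type with distortion `C`. -/
def HasStrictDistortedNegativeType {X : Type*} (D : SemiMetric X) (p C : ℝ) : Prop :=
  D.HasDistortedNegativeType p C ∧
    ∀ n : ℕ, 2 ≤ n → ∀ x : Fin n → X, Function.Injective x →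
      ∀ Q ∈ nullPSD n, D.distortedSum p C x Q = 0 → Q = 0

/-- The map `f` has distortion at most `C`. -/
def HasDistortionAtMost {X Y : Type*} (DX : SemiMetric X) (DY : SemiMetric Y) (f : X → Y)
    (C : ℝ) : Prop :=
  ∃ s : ℝ, 0 < s ∧ ∀ x y,
    s * DX.d x y ≤ DY.d (f x) (f y) ∧ DY.d (f x) (f y) ≤ s * C * DX.d x y

/-- The distortion of `f`, in `[1, ∞]`; it is `∞` if `f` is not a bi-Lipschitz embedding. -/
def distortion {X Y : Type*} (DX : SemiMetric X) (DY : SemiMetric Y) (f : X → Y) : EReal :=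
  sInf ((fun C : ℝ => (C : EReal)) '' {C : ℝ | 1 ≤ C ∧ HasDistortionAtMost DX DY f C})

/-- The least distortion `c_Y(X)`, in `[1, ∞]`, of maps from `X` to `Y`. -/
def leastDistortion {X Y : Type*} (DX : SemiMetric X) (DY : SemiMetric Y) : EReal :=
  sInf {C : EReal | 1 ≤ C ∧ ∃ f : X → Y, distortion DX DY f ≤ C}

/-- The Euclidean distortion `c₂(X)`, that is, `c_Y(X)` for the real sequence space `Y = ℓ²`. -/
def euclideanDistortion {X : Type*} (D : SemiMetric X) : EReal :=
  leastDistortion D (ofMetric (lp (fun _ : ℕ => ℝ) 2))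

end SemiMetric

end

/-! The distorted sum is affine in `C²` with slope `negSum ≤ 0`, and for injective `x` and `Q` in
`nullPSD` the slope vanishes only at `Q = 0`. Hence distorted negative type becomes strict as soon
as `C` grows. On a finite space, Hahn–Banach duality (`exists_condNegDef_between`) identifies
distorted negative type with the existence of a Euclidean embedding of `d^(p/2)` of distortion at
most `C`.

For `C = 1` the sum is the plain pairing of `d^p` with `Q`; splitting `Q` into rank-one pieces
reduces it to quadratic forms on zero-sum vectors. Writing `x^α` as an integral of resolvents
(`CondNegDef.rpow_neg`) shows that `q`-negative type forces strict `p`-negative type for `0 < p <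
q`; the case `p = 0` is direct.

Conversely, strictness is an open condition, because unit spheres are compact. If `C > 1`, it
survives a small decrease of `C`, and duality gives an embedding. If `C = 1`, no decrease is
allowed, but it survives a small increase of `p`. -/

namespace Matrix

variable {ι : Type*} [Fintype ι]

/-! ### Schoenberg's theorem: kernels built from conditionally negative definite matrices -/

theorem posSemidef_iff_sum {M : Matrix ι ι ℝ} :
    M.PosSemidef ↔ (∀ i j, M i j = M j i) ∧ ∀ ξ : ι → ℝ, 0 ≤ ∑ i, ∑ j, M i j * ξ i * ξ j := by
  have key : ∀ ξ : ι → ℝ, star ξ ⬝ᵥ (M *ᵥ ξ) = ∑ i, ∑ j, M i j * ξ i * ξ j := fun ξ => by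
    simp only [dotProduct, mulVec, Finset.mul_sum, star_trivial]
    exact Finset.sum_congr rfl fun i _ => Finset.sum_congr rfl fun j _ => by ring
  rw [posSemidef_iff_dotProduct_mulVec]
  simp only [key]
  refine and_congr_left fun _ => ⟨fun h i j => ?_, fun h => ?_⟩
  · simpa using h.apply j i
  · ext i j
    simpa using h j i

/-- The entries of a conditionally negative definite matrix. -/
structure CondNegDef (M : Matrix ι ι ℝ) : Prop where
  symm : ∀ i j, M i j = M j i
  diag : ∀ i, M i i = 0
  nonpos : ∀ ξ : ι → ℝ, ∑ i, ξ i = 0 → ∑ i, ∑ j, M i j * ξ i * ξ j ≤ 0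

/-- Moving the total mass of `ξ` to `a` gives the zero-sum vector `ξ - S δ_a`; the `S²` term dies
with the diagonal. Geometrically, this is twice the Gram matrix with origin `a`. -/
theorem CondNegDef.posSemidef_gram {M : Matrix ι ι ℝ} (hM : M.CondNegDef) (a : ι) :
    (of fun i j => M i a + M a j - M i j : Matrix ι ι ℝ).PosSemidef := by
  classical
  refine posSemidef_iff_sum.2 ⟨fun i j => ?_, fun ξ => ?_⟩
  · simp only [of_apply]
    rw [hM.symm i a, hM.symm a j, hM.symm i j]
    ring
  · set S := ∑ i, ξ i with hS
    have h := hM.nonpos (fun i => ξ i - Pi.single (M := fun _ => ℝ) a S i) (by simp [hS])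
    have e1 : ∑ i, ∑ j, M i j * (ξ i - Pi.single (M := fun _ => ℝ) a S i) *
        (ξ j - Pi.single (M := fun _ => ℝ) a S j) =
        ∑ i, ∑ j, M i j * ξ i * ξ j - (∑ i, M i a * ξ i) * S - S * ∑ j, M a j * ξ j := by
      simp only [mul_sub, sub_mul, Finset.sum_sub_distrib, Pi.single_apply, mul_ite, ite_mul,
        mul_zero, zero_mul, Finset.sum_ite_eq', Finset.mem_univ, if_true, Finset.sum_ite_irrel,
        Finset.sum_const_zero, hM.diag, Finset.sum_mul, Finset.mul_sum]
      have : ∀ j, M a j * S * ξ j = S * (M a j * ξ j) := fun j => by ring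
      simp only [this]
      ring
    have e2 : ∑ i, ∑ j, (of fun i j => M i a + M a j - M i j : Matrix ι ι ℝ) i j * ξ i * ξ j =
        (∑ i, M i a * ξ i) * S + S * ∑ j, M a j * ξ j - ∑ i, ∑ j, M i j * ξ i * ξ j := by
      rw [hS, Finset.sum_mul_sum, Finset.sum_mul_sum, ← Finset.sum_add_distrib,
        ← Finset.sum_sub_distrib]
      refine Finset.sum_congr rfl fun i _ => ?_
      rw [← Finset.sum_add_distrib, ← Finset.sum_sub_distrib]
      exact Finset.sum_congr rfl fun j _ => by simp only [of_apply]; ring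
    rw [e1] at h
    rw [e2]
    linarith

theorem PosSemidef.of_mul {A B : Matrix ι ι ℝ} (hA : A.PosSemidef) (hB : B.PosSemidef) :
    (of fun i j => A i j * B i j : Matrix ι ι ℝ).PosSemidef :=
  PosSemidef.hadamard hA hB

theorem PosSemidef.hadamard_pow {M : Matrix ι ι ℝ} (hM : M.PosSemidef) (n : ℕ) :
    (of fun i j => M i j ^ n : Matrix ι ι ℝ).PosSemidef := by
  induction n with
  | zero =>
    convert posSemidef_vecMulVec_self_star (fun _ : ι => (1 : ℝ)) using 1
    ext i j
    simp [vecMulVec_apply]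
  | succ n ih =>
    convert ih.of_mul hM using 1
    ext i j
    simp [pow_succ]

/-- The entrywise exponential is the limit of `(1 + M/n)^n`, whose entrywise powers are Schur
products. -/
theorem PosSemidef.hadamard_exp {M : Matrix ι ι ℝ} (hM : M.PosSemidef) :
    (of fun i j => Real.exp (M i j) : Matrix ι ι ℝ).PosSemidef := by
  have h : ∀ n : ℕ, (of fun i j => (1 + M i j / n) ^ n : Matrix ι ι ℝ).PosSemidef := fun n => by
    have h1 : (of fun i j => 1 + M i j / n : Matrix ι ι ℝ).PosSemidef := by
      convert (posSemidef_vecMulVec_self_star (fun _ : ι => (1 : ℝ))).add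
        (hM.smul (inv_nonneg.2 n.cast_nonneg : (0 : ℝ) ≤ (n : ℝ)⁻¹)) using 1
      ext i j
      simp [vecMulVec_apply]
      ring
    simpa using h1.hadamard_pow n
  refine posSemidef_iff_sum.2 ⟨fun i j => ?_, fun ξ => ?_⟩
  · simp only [of_apply]
    rw [(posSemidef_iff_sum.1 hM).1 i j]
  · refine ge_of_tendsto' (x := Filter.atTop) ?_ fun n => (posSemidef_iff_sum.1 (h n)).2 ξ
    refine tendsto_finsetSum _ fun i _ => tendsto_finsetSum _ fun j _ => ?_
    simp only [of_apply]
    exact ((Real.tendsto_one_add_div_pow_exp (M i j)).mul_const _).mul_const _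

/-- The kernel is the exponential of `t` times the Gram matrix at `a`, Schur-multiplied by a
rank-one matrix. -/
theorem CondNegDef.posSemidef_exp {M : Matrix ι ι ℝ} (hM : M.CondNegDef) {t : ℝ} (ht : 0 ≤ t) :
    (of fun i j => Real.exp (-(t * M i j)) : Matrix ι ι ℝ).PosSemidef := by
  rcases isEmpty_or_nonempty ι with hι | ⟨⟨a⟩⟩
  · exact posSemidef_iff_sum.2 ⟨fun i => hι.elim i, by simp⟩
  · convert ((hM.posSemidef_gram a).smul ht).hadamard_exp.of_mul
      (posSemidef_vecMulVec_self_star fun i => Real.exp (-(t * M i a))) using 1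
    ext i j
    simp only [of_apply, vecMulVec_apply, smul_apply, smul_eq_mul,
      star_trivial, ← Real.exp_add]
    rw [hM.symm a j]
    ring_nf

/-! ### Resolvents and fractional powers -/

open MeasureTheory in
-- By the Laplace transform, the resolvent is a positive mixture of the kernels `exp (-s M)`.
theorem CondNegDef.posSemidef_inv {M : Matrix ι ι ℝ} (hM : M.CondNegDef)
    (h0 : ∀ i j, 0 ≤ M i j) {t : ℝ} (ht : 0 < t) :
    (of fun i j => (t + M i j)⁻¹ : Matrix ι ι ℝ).PosSemidef := by
  refine posSemidef_iff_sum.2 ⟨fun i j => ?_, fun ξ => ?_⟩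
  · simp only [of_apply]
    rw [hM.symm i j]
  · have hpos : ∀ i j, -(t + M i j) < 0 := fun i j => by linarith [h0 i j]
    have hint : ∀ i j, (t + M i j)⁻¹ = ∫ s in Set.Ioi (0 : ℝ), Real.exp (-(t + M i j) * s) :=
      fun i j => by
        rw [integral_exp_mul_Ioi (hpos i j)]
        rw [mul_zero, Real.exp_zero, neg_div_neg_eq, one_div]
    have hi : ∀ i j, IntegrableOn (fun s : ℝ => Real.exp (-(t + M i j) * s)) (Set.Ioi 0) :=
      fun i j => integrableOn_exp_mul_Ioi (hpos i j) 0
    have hform : ∑ i, ∑ j, (of fun i j => (t + M i j)⁻¹ : Matrix ι ι ℝ) i j * ξ i * ξ j =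
        ∫ s in Set.Ioi (0 : ℝ), ∑ i, ∑ j, Real.exp (-(t + M i j) * s) * ξ i * ξ j := by
      rw [integral_finsetSum _ fun i _ => integrable_finsetSum _ fun j _ =>
        ((hi i j).mul_const _).mul_const _]
      refine Finset.sum_congr rfl fun i _ => ?_
      rw [integral_finsetSum _ fun j _ => ((hi i j).mul_const _).mul_const _]
      refine Finset.sum_congr rfl fun j _ => ?_
      rw [integral_mul_const, integral_mul_const, ← hint, of_apply]
    rw [hform]
    refine setIntegral_nonneg measurableSet_Ioi fun s hs => ?_
    have h := (posSemidef_iff_sum.1 (hM.posSemidef_exp (le_of_lt hs))).2 ξ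
    have e : ∑ i, ∑ j, Real.exp (-(t + M i j) * s) * ξ i * ξ j = Real.exp (-(t * s)) *
        ∑ i, ∑ j, (of fun i j => Real.exp (-(s * M i j)) : Matrix ι ι ℝ) i j * ξ i * ξ j := by
      simp only [Finset.mul_sum, of_apply, ← mul_assoc, ← Real.exp_add]
      refine Finset.sum_congr rfl fun i _ => Finset.sum_congr rfl fun j _ => ?_
      ring_nf
    rw [e]
    exact mul_nonneg (Real.exp_pos _).le h

/-- For `x > 0` the resolvent kernel `t * (t + x)⁻¹` tends to `0` as `t → 0⁺`, and it is
constantly `1` for `x = 0`: near `t = 0` its quadratic form is close to `∑ ξ²`. -/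
theorem tendsto_sum_resolvent {M : Matrix ι ι ℝ} (hd : ∀ i, M i i = 0)
    (h0 : ∀ i j, i ≠ j → 0 < M i j) (ξ : ι → ℝ) :
    Filter.Tendsto (fun t : ℝ => ∑ i, ∑ j, t * (t + M i j)⁻¹ * ξ i * ξ j)
      (nhdsWithin 0 (Set.Ioi 0)) (nhds (∑ i, ξ i ^ 2)) := by
  classical
  have e : ∑ i, ξ i ^ 2 = ∑ i, ∑ j, (if i = j then (1 : ℝ) else 0) * ξ i * ξ j := by
    simp [sq]
  rw [e]
  refine tendsto_finsetSum _ fun i _ => tendsto_finsetSum _ fun j _ => ?_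
  refine (Filter.Tendsto.mul_const _ ?_).mul_const _
  split_ifs with hij
  · subst hij
    refine tendsto_const_nhds.congr' ?_
    filter_upwards [self_mem_nhdsWithin] with t ht
    rw [hd, add_zero, mul_inv_cancel₀ (ne_of_gt ht)]
  · have hc : ContinuousAt (fun t : ℝ => t * (t + M i j)⁻¹) 0 :=
      continuousAt_id.mul ((continuousAt_id.add continuousAt_const).inv₀
        (by simpa using (h0 i j hij).ne'))
    have := hc.tendsto
    rw [zero_mul] at this
    exact this.mono_left nhdsWithin_le_nhds

open MeasureTheory Real in
-- Up to a positive constant, `x^α = ∫ t^α (t⁻¹ - (t + x)⁻¹) dt`. On zero-sum vectors the `t⁻¹` term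
-- drops out, leaving minus a positive semidefinite resolvent form.
theorem CondNegDef.rpow_neg {M : Matrix ι ι ℝ} (hM : M.CondNegDef)
    (h0 : ∀ i j, i ≠ j → 0 < M i j) {α : ℝ} (hα : α ∈ Set.Ioo (0 : ℝ) 1) {ξ : ι → ℝ}
    (hξ : ∑ i, ξ i = 0) (hne : ξ ≠ 0) : ∑ i, ∑ j, M i j ^ α * ξ i * ξ j < 0 := by
  have hnn : ∀ i j, 0 ≤ M i j := fun i j => by
    rcases eq_or_ne i j with rfl | h
    · exact (hM.diag i).ge
    · exact (h0 i j h).le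
  set F : ℝ → ℝ := fun t => ∑ i, ∑ j, rpowIntegrand₀₁ α t (M i j) * ξ i * ξ j with hF
  have hint : ∀ i j, IntegrableOn (fun t => rpowIntegrand₀₁ α t (M i j)) (Set.Ioi 0) := fun i j =>
    integrableOn_rpowIntegrand₀₁_Ioi hα (hnn i j)
  have hFint : IntegrableOn F (Set.Ioi 0) :=
    integrable_finsetSum _ fun i _ => integrable_finsetSum _ fun j _ =>
      ((hint i j).mul_const _).mul_const _
  have hform : ∑ i, ∑ j, M i j ^ α * ξ i * ξ j =
      (∫ t in Set.Ioi (0 : ℝ), rpowIntegrand₀₁ α t 1)⁻¹ * ∫ t in Set.Ioi (0 : ℝ), F t := by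
    rw [hF, integral_finsetSum _ fun i _ => integrable_finsetSum _ fun j _ =>
        ((hint i j).mul_const _).mul_const _, Finset.mul_sum]
    refine Finset.sum_congr rfl fun i _ => ?_
    rw [integral_finsetSum _ fun j _ => ((hint i j).mul_const _).mul_const _, Finset.mul_sum]
    refine Finset.sum_congr rfl fun j _ => ?_
    rw [integral_mul_const, integral_mul_const, rpow_eq_const_mul_integral hα (hnn i j)]
    ring
  have hFeq : ∀ t : ℝ, 0 < t → F t = -(t ^ α * ∑ i, ∑ j, (t + M i j)⁻¹ * ξ i * ξ j) := by
    intro t ht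
    have hS : ∑ i, ∑ j, t ^ α * t⁻¹ * ξ i * ξ j = 0 := by
      simp only [← Finset.mul_sum, hξ, mul_zero, Finset.sum_const_zero]
    rw [← zero_sub, ← hS, hF]
    simp only [Finset.mul_sum, ← Finset.sum_sub_distrib]
    refine Finset.sum_congr rfl fun i _ => Finset.sum_congr rfl fun j _ => ?_
    rw [rpowIntegrand₀₁]
    ring
  have hFnonpos : ∀ t : ℝ, 0 < t → F t ≤ 0 := fun t ht => by
    rw [hFeq t ht, neg_nonpos]
    exact mul_nonneg (rpow_nonneg ht.le _) ((posSemidef_iff_sum.1 (hM.posSemidef_inv hnn ht)).2 ξ)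
  have hsq : 0 < ∑ i, ξ i ^ 2 := by
    obtain ⟨i, hi⟩ := Function.ne_iff.1 hne
    exact Finset.sum_pos' (fun i _ => sq_nonneg _) ⟨i, Finset.mem_univ i, by
      have : ξ i ≠ 0 := hi
      positivity⟩
  -- Strictness: near `t = 0` the rescaled form is close to `∑ ξ²`, so the integrand is negative on
  -- a set of positive measure.
  obtain ⟨ε, hε, hεs⟩ := mem_nhdsGT_iff_exists_Ioo_subset.1
    ((tendsto_sum_resolvent hM.diag h0 ξ).eventually (lt_mem_nhds hsq))
  have hFneg : ∀ t ∈ Set.Ioo 0 ε, F t < 0 := fun t ht => by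
    have h := hεs ht
    replace h : 0 < ∑ i, ∑ j, t * (t + M i j)⁻¹ * ξ i * ξ j := h
    have e : ∑ i, ∑ j, t * (t + M i j)⁻¹ * ξ i * ξ j =
        t * ∑ i, ∑ j, (t + M i j)⁻¹ * ξ i * ξ j := by
      simp only [Finset.mul_sum, mul_assoc]
    rw [hFeq t ht.1, neg_lt_zero]
    exact mul_pos (rpow_pos_of_pos ht.1 _) (pos_of_mul_pos_right (e ▸ h) ht.1.le)
  have hI : 0 < ∫ t in Set.Ioi (0 : ℝ), (-F) t := by
    rw [setIntegral_pos_iff_support_of_nonneg_ae _ hFint.neg]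
    · refine lt_of_lt_of_le ?_ (measure_mono (μ := volume) (s := Set.Ioo 0 ε) fun t ht =>
        ⟨?_, ht.1⟩)
      · simpa using hε
      · simpa using (hFneg t ht).ne
    · filter_upwards [ae_restrict_mem measurableSet_Ioi] with t ht
      simpa using hFnonpos t ht
  rw [integral_neg', neg_pos] at hI
  rw [hform]
  exact mul_neg_of_pos_of_neg (inv_pos.2 (integral_rpowIntegrand₀₁_one_pos hα)) hI

/-! ### Rank-one splittings and the cone of squared distances -/

theorem PosSemidef.exists_sum_mul {Q : Matrix ι ι ℝ} (hQ : Q.PosSemidef) :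
    ∃ (m : ℕ) (v : Fin m → ι → ℝ), ∀ i j, Q i j = ∑ k, v k i * v k j := by
  obtain ⟨m, v, h⟩ := posSemidef_iff_eq_sum_vecMulVec.1 hQ
  exact ⟨m, v, fun i j => by simp [h, sum_apply, vecMulVec_apply]⟩

/-- The sum of all entries of `Q` is `∑ k, (∑ i, v k i)²`. -/
theorem sum_eq_zero_of_sum_mul {Q : Matrix ι ι ℝ} {m : ℕ} {v : Fin m → ι → ℝ}
    (h : ∀ i j, Q i j = ∑ k, v k i * v k j) (h0 : ∀ i, ∑ j, Q i j = 0) (k : Fin m) :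
    ∑ i, v k i = 0 := by
  have hs : ∑ k, (∑ i, v k i) ^ 2 = 0 := by
    rw [← Finset.sum_eq_zero fun i (_ : i ∈ Finset.univ) => h0 i]
    simp only [h, sq, Finset.sum_mul_sum]
    rw [Finset.sum_comm]
    exact Finset.sum_congr rfl fun i _ => Finset.sum_comm
  exact pow_eq_zero_iff two_ne_zero |>.1
    ((Finset.sum_eq_zero_iff_of_nonneg fun k _ => sq_nonneg _).1 hs k (Finset.mem_univ k))

theorem sum_mul_eq_of_sum_mul {Q : Matrix ι ι ℝ} {m : ℕ} {v : Fin m → ι → ℝ}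
    (h : ∀ i j, Q i j = ∑ k, v k i * v k j) (M : ι → ι → ℝ) :
    ∑ i, ∑ j, M i j * Q i j = ∑ k, ∑ i, ∑ j, M i j * v k i * v k j := by
  simp only [h, Finset.mul_sum, ← mul_assoc]
  exact (Finset.sum_congr rfl fun i _ => Finset.sum_comm).trans Finset.sum_comm

theorem isClosed_condNegDef : IsClosed {M : ι → ι → ℝ | (of M).CondNegDef} := by
  have e : {M : ι → ι → ℝ | (of M).CondNegDef} =
      (⋂ i, ⋂ j, {M | M i j = M j i}) ∩ (⋂ i, {M | M i i = 0}) ∩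
        ⋂ ξ : ι → ℝ, ⋂ _ : ∑ i, ξ i = 0, {M | ∑ i, ∑ j, M i j * ξ i * ξ j ≤ 0} := by
    ext M
    simp only [Set.mem_inter_iff, Set.mem_iInter]
    exact ⟨fun h => ⟨⟨h.symm, h.diag⟩, h.nonpos⟩, fun h => ⟨h.1.1, h.1.2, h.2⟩⟩
  rw [e]
  refine ((isClosed_iInter fun i => isClosed_iInter fun j => isClosed_eq ?_ ?_).inter
    (isClosed_iInter fun i => isClosed_eq ?_ ?_)).inter
    (isClosed_iInter fun ξ => isClosed_iInter fun _ => isClosed_le ?_ ?_) <;> fun_prop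

theorem CondNegDef.smul {M : ι → ι → ℝ} (hM : (of M).CondNegDef) {a : ℝ} (ha : 0 ≤ a) :
    (of (a • M)).CondNegDef where
  symm i j := congrArg (a * ·) (hM.symm i j)
  diag i := (congrArg (a * ·) (hM.diag i)).trans (mul_zero a)
  nonpos ξ hξ := by
    have := mul_nonpos_of_nonneg_of_nonpos ha (hM.nonpos ξ hξ)
    simp only [Finset.mul_sum, ← mul_assoc] at this
    exact this

theorem CondNegDef.add {M N : ι → ι → ℝ} (hM : (of M).CondNegDef) (hN : (of N).CondNegDef) :
    (of (M + N)).CondNegDef where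
  symm i j := congrArg₂ (· + ·) (hM.symm i j) (hN.symm i j)
  diag i := (congrArg₂ (· + ·) (hM.diag i) (hN.diag i)).trans (add_zero 0)
  nonpos ξ hξ := by
    have := add_nonpos (hM.nonpos ξ hξ) (hN.nonpos ξ hξ)
    simp only [← Finset.sum_add_distrib, ← add_mul] at this
    exact this

/-- On zero-sum `ξ` the form equals `-2 (∑ v i ξ i)²`. -/
theorem condNegDef_sq_sub (v : ι → ℝ) : (of fun i j => (v i - v j) ^ 2).CondNegDef where
  symm i j := by simp only [of_apply]; ring
  diag i := by simp
  nonpos ξ hξ := by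
    have e : ∑ i, ∑ j, (of fun i j => (v i - v j) ^ 2 : Matrix ι ι ℝ) i j * ξ i * ξ j =
        (∑ i, v i ^ 2 * ξ i) * (∑ j, ξ j) + (∑ i, ξ i) * (∑ j, v j ^ 2 * ξ j) -
          2 * ((∑ i, v i * ξ i) * ∑ j, v j * ξ j) := by
      simp only [Finset.sum_mul_sum]
      simp only [Finset.mul_sum, ← Finset.sum_add_distrib, ← Finset.sum_sub_distrib, of_apply]
      exact Finset.sum_congr rfl fun i _ => Finset.sum_congr rfl fun j _ => by ring
    rw [e, hξ]
    nlinarith [mul_self_nonneg (∑ i, v i * ξ i)]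

/-- Lets positivity of `Q` be tested by pairing it with squared differences. -/
theorem sum_mul_sq_sub {Q : Matrix ι ι ℝ} (hs : ∀ i j, Q i j = Q j i)
    (h0 : ∀ i, ∑ j, Q i j = 0) (v : ι → ℝ) :
    ∑ i, ∑ j, (v i - v j) ^ 2 * Q i j = -2 * ∑ i, ∑ j, Q i j * v i * v j := by
  have h1 : ∑ i, ∑ j, v i ^ 2 * Q i j = 0 := by
    simp [← Finset.mul_sum, h0]
  have h2 : ∑ i, ∑ j, v j ^ 2 * Q i j = 0 := by
    rw [Finset.sum_comm, ← h1]
    exact Finset.sum_congr rfl fun i _ => Finset.sum_congr rfl fun j _ => by rw [hs j i]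
  have e : ∑ i, ∑ j, (v i - v j) ^ 2 * Q i j = ∑ i, ∑ j, v i ^ 2 * Q i j +
      ∑ i, ∑ j, v j ^ 2 * Q i j - 2 * ∑ i, ∑ j, Q i j * v i * v j := by
    simp only [Finset.mul_sum, ← Finset.sum_add_distrib, ← Finset.sum_sub_distrib]
    exact Finset.sum_congr rfl fun i _ => Finset.sum_congr rfl fun j _ => by ring
  rw [e, h1, h2]
  ring

/-- A conditionally negative definite matrix is a matrix of squared Euclidean distances. -/
theorem CondNegDef.exists_lp {M : Matrix ι ι ℝ} (hM : M.CondNegDef) :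
    ∃ g : ι → lp (fun _ : ℕ => ℝ) 2, ∀ i j, dist (g i) (g j) ^ 2 = M i j := by
  rcases isEmpty_or_nonempty ι with hι | ⟨⟨a⟩⟩
  · exact ⟨fun _ => 0, fun i => hι.elim i⟩
  -- Halving makes the columns of `v` points with squared norm `M i a` and squared distances `M i
  -- j`.
  obtain ⟨m, v, hv⟩ := ((hM.posSemidef_gram a).smul
    (show (0 : ℝ) ≤ 1 / 2 by norm_num)).exists_sum_mul
  let V : ι → ℕ → ℝ := fun i k => if h : k < m then v ⟨k, h⟩ i else 0
  refine ⟨fun i => ∑ k ∈ Finset.range m, lp.single 2 k (V i k), fun i j => ?_⟩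
  have h := lp.norm_sum_single (E := fun _ : ℕ => ℝ) (p := 2) (by norm_num)
    (fun k => V i k - V j k) (Finset.range m)
  simp only [ENNReal.toReal_ofNat, Real.rpow_ofNat, Real.norm_eq_abs, sq_abs] at h
  rw [dist_eq_norm, ← Finset.sum_sub_distrib]
  simp only [← lp.single_sub]
  rw [h, Finset.sum_range]
  have e : ∑ k : Fin m, (V i k - V j k) ^ 2 = ∑ k, v k i * v k i + ∑ k, v k j * v k j -
      2 * ∑ k, v k i * v k j := by
    simp only [Finset.mul_sum, ← Finset.sum_add_distrib, ← Finset.sum_sub_distrib]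
    refine Finset.sum_congr rfl fun k _ => ?_
    simp only [V, Fin.is_lt, dite_true, Fin.eta]
    ring
  rw [e, ← hv, ← hv, ← hv]
  simp only [smul_apply, of_apply, smul_eq_mul, hM.diag, hM.symm a]
  ring

end Matrix

/-! ### Powers of a semi-metric and ordinary negative type -/

namespace SemiMetric

open Matrix Filter Topology

variable {X : Type*} {D : SemiMetric X} {p C : ℝ} {n : ℕ}

theorem pow_d_pos (D : SemiMetric X) (p : ℝ) {a b : X} (h : a ≠ b) : 0 < (D.pow p).d a b :=
  lt_of_le_of_ne ((D.pow p).nonneg a b) fun e => h (((D.pow p).eq_zero_iff a b).1 e.symm)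

theorem d_self (D : SemiMetric X) (a : X) : D.d a a = 0 := (D.eq_zero_iff a a).2 rfl

theorem pow_zero_d [DecidableEq X] (D : SemiMetric X) (a b : X) :
    (D.pow 0).d a b = if a = b then 0 else 1 := by
  simp [pow, D.eq_zero_iff]

theorem pow_d_rpow (D : SemiMetric X) {p α : ℝ} (hα : α ≠ 0) (a b : X) :
    (D.pow p).d a b ^ α = (D.pow (p * α)).d a b := by
  simp only [pow]
  split_ifs
  · exact Real.zero_rpow hα
  · rw [Real.rpow_mul (D.nonneg a b)]

theorem pow_half_d_sq (D : SemiMetric X) (p : ℝ) (a b : X) :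
    (D.pow (p / 2)).d a b ^ 2 = (D.pow p).d a b := by
  rw [← Real.rpow_two, D.pow_d_rpow two_ne_zero, div_mul_cancel₀ p two_ne_zero]

theorem continuous_pow_d (D : SemiMetric X) (a b : X) : Continuous fun p => (D.pow p).d a b := by
  simp only [pow]
  split_ifs with h
  · exact continuous_const
  · exact Real.continuous_const_rpow h

theorem HasNegativeType.condNegDef (h : D.HasNegativeType p) (hn : 2 ≤ n) {x : Fin n → X}
    (hx : Function.Injective x) : (of fun i j => (D.pow p).d (x i) (x j)).CondNegDef where
  symm _ _ := (D.pow p).symm _ _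
  diag _ := (D.pow p).d_self _
  nonpos := h n hn x hx

/-- Negative type is inherited, in strict form, by all smaller exponents. -/
theorem HasNegativeType.sum_neg_of_lt {q : ℝ} (h : D.HasNegativeType q) (hp : 0 ≤ p) (hpq : p < q)
    (hn : 2 ≤ n) {x : Fin n → X} (hx : Function.Injective x) {ξ : Fin n → ℝ}
    (hξ : ∑ i, ξ i = 0) (hne : ξ ≠ 0) :
    ∑ i, ∑ j, (D.pow p).d (x i) (x j) * ξ i * ξ j < 0 := by
  classical
  rcases hp.eq_or_lt with rfl | hp
  -- For the discrete metric the form is `-∑ ξ²`.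
  · have e : ∀ i j, (D.pow 0).d (x i) (x j) * ξ i * ξ j =
        ξ i * ξ j - if i = j then ξ i * ξ j else 0 := fun i j => by
      simp only [pow_zero_d, hx.eq_iff]
      split_ifs <;> ring
    simp only [e, Finset.sum_sub_distrib, ← Finset.sum_mul_sum, hξ, Finset.sum_ite_eq,
      Finset.mem_univ, if_true, zero_mul, zero_sub, neg_lt_zero]
    obtain ⟨i, hi⟩ := Function.ne_iff.1 hne
    exact Finset.sum_pos' (fun i _ => mul_self_nonneg _)
      ⟨i, Finset.mem_univ i, mul_self_pos.2 hi⟩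
  · have hq : 0 < q := hp.trans hpq
    have := (h.condNegDef hn hx).rpow_neg (fun i j hij => D.pow_d_pos q (hx.ne hij))
      (α := p / q) ⟨by positivity, (div_lt_one hq).2 hpq⟩ hξ hne
    simpa only [of_apply, D.pow_d_rpow (div_pos hp hq).ne', mul_div_cancel₀ p hq.ne'] using this

/-! ### Distorted sums and their dependence on the distortion -/

theorem mem_nullPSD_iff {Q : Matrix (Fin n) (Fin n) ℝ} :
    Q ∈ nullPSD n ↔ (∀ i j, Q i j = Q j i) ∧ (∀ ξ : Fin n → ℝ, 0 ≤ ∑ i, ∑ j, Q i j * ξ i * ξ j) ∧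
      ∀ i, ∑ j, Q i j = 0 := by
  have : Q *ᵥ 1 = 0 ↔ ∀ i, ∑ j, Q i j = 0 := by
    simp [funext_iff, mulVec, dotProduct]
  rw [nullPSD, Set.mem_ofPred_eq, posSemidef_iff_sum, this, and_assoc]

theorem vecMulVec_mem_nullPSD {ξ : Fin n → ℝ} (hξ : ∑ i, ξ i = 0) : vecMulVec ξ ξ ∈ nullPSD n := by
  refine mem_nullPSD_iff.2 ⟨fun i j => mul_comm _ _, fun η => ?_, fun i => ?_⟩
  · have e : ∑ i, ∑ j, vecMulVec ξ ξ i j * η i * η j = (∑ i, ξ i * η i) * ∑ j, ξ j * η j := by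
      rw [Finset.sum_mul_sum]
      exact Finset.sum_congr rfl fun i _ => Finset.sum_congr rfl fun j _ => by
        rw [vecMulVec_apply]; ring
    rw [e]
    exact mul_self_nonneg _
  · simp [vecMulVec_apply, ← Finset.mul_sum, hξ]

/-- The contribution of the negative entries of `Q` to the distorted sum. -/
noncomputable def negSum (D : SemiMetric X) (p : ℝ) (x : Fin n → X) (Q : Matrix (Fin n) (Fin n) ℝ) : ℝ :=
  ∑ i, ∑ j, if Q i j < 0 then (D.pow p).d (x i) (x j) * Q i j else 0

theorem distortedSum_one (D : SemiMetric X) (p : ℝ) (x : Fin n → X)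
    (Q : Matrix (Fin n) (Fin n) ℝ) :
    D.distortedSum p 1 x Q = ∑ i, ∑ j, (D.pow p).d (x i) (x j) * Q i j := by
  rw [distortedSum, one_pow, one_mul, ← Finset.sum_add_distrib]
  refine Finset.sum_congr rfl fun i _ => ?_
  rw [← Finset.sum_add_distrib]
  refine Finset.sum_congr rfl fun j _ => ?_
  rcases lt_trichotomy (Q i j) 0 with h | h | h
  · simp [h, h.not_gt]
  · simp [h]
  · simp [h, h.not_gt]

theorem distortedSum_eq_add (D : SemiMetric X) (p C C' : ℝ) (x : Fin n → X)
    (Q : Matrix (Fin n) (Fin n) ℝ) :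
    D.distortedSum p C x Q = D.distortedSum p C' x Q + (C ^ 2 - C' ^ 2) * D.negSum p x Q := by
  rw [distortedSum, distortedSum, negSum]
  ring

theorem negSum_term_nonpos (D : SemiMetric X) (p : ℝ) (x : Fin n → X)
    (Q : Matrix (Fin n) (Fin n) ℝ) (i j : Fin n) :
    (if Q i j < 0 then (D.pow p).d (x i) (x j) * Q i j else 0) ≤ 0 := by
  split_ifs with h
  · exact mul_nonpos_of_nonneg_of_nonpos ((D.pow p).nonneg _ _) h.le
  · exact le_rfl

theorem negSum_nonpos (D : SemiMetric X) (p : ℝ) (x : Fin n → X)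
    (Q : Matrix (Fin n) (Fin n) ℝ) : D.negSum p x Q ≤ 0 :=
  Finset.sum_nonpos fun i _ => Finset.sum_nonpos fun j _ => D.negSum_term_nonpos p x Q i j

/-- Off-diagonal distances are positive, so no entry of `Q` is negative; zero row sums then kill
every entry. -/
theorem eq_zero_of_negSum_eq_zero {x : Fin n → X} (hx : Function.Injective x)
    {Q : Matrix (Fin n) (Fin n) ℝ} (hQ : Q ∈ nullPSD n) (h : D.negSum p x Q = 0) : Q = 0 := by
  have hnn : ∀ i j, 0 ≤ Q i j := fun i j => by
    rcases eq_or_ne i j with rfl | hij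
    · exact hQ.1.diag_nonneg
    · by_contra! hneg
      have h1 := (Finset.sum_eq_zero_iff_of_nonpos fun i _ => Finset.sum_nonpos fun j _ =>
        D.negSum_term_nonpos p x Q i j).1 h i (Finset.mem_univ i)
      have h2 := (Finset.sum_eq_zero_iff_of_nonpos fun j _ =>
        D.negSum_term_nonpos p x Q i j).1 h1 j (Finset.mem_univ j)
      rw [if_pos hneg] at h2
      exact (mul_neg_of_pos_of_neg (D.pow_d_pos p (hx.ne hij)) hneg).ne h2
  ext i j
  exact (Finset.sum_eq_zero_iff_of_nonneg fun j _ => hnn i j).1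
    ((mem_nullPSD_iff.1 hQ).2.2 i) j (Finset.mem_univ j)

theorem HasStrictDistortedNegativeType.mono {C' : ℝ} (h : D.HasStrictDistortedNegativeType p C)
    (hC : 0 ≤ C) (hCC : C ≤ C') : D.HasStrictDistortedNegativeType p C' := by
  have hle : ∀ {n : ℕ} (x : Fin n → X) (Q : Matrix (Fin n) (Fin n) ℝ),
      D.distortedSum p C' x Q ≤ D.distortedSum p C x Q := fun x Q => by
    rw [D.distortedSum_eq_add p C' C]
    have := mul_nonpos_of_nonneg_of_nonpos
      (sub_nonneg.2 (pow_le_pow_left₀ hC hCC 2)) (D.negSum_nonpos p x Q)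
    linarith
  exact ⟨fun n hn x hx Q hQ => (hle x Q).trans (h.1 n hn x hx Q hQ), fun n hn x hx Q hQ h0 =>
    h.2 n hn x hx Q hQ (le_antisymm (h.1 n hn x hx Q hQ) (h0 ▸ hle x Q))⟩

theorem HasDistortedNegativeType.strict_of_lt {C' : ℝ} (h : D.HasDistortedNegativeType p C)
    (hC : 0 ≤ C) (hCC : C < C') : D.HasStrictDistortedNegativeType p C' := by
  have hpos : 0 < C' ^ 2 - C ^ 2 := sub_pos.2 (pow_lt_pow_left₀ hCC hC two_ne_zero)
  refine ⟨fun n hn x hx Q hQ => ?_, fun n hn x hx Q hQ h0 => ?_⟩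
  · rw [D.distortedSum_eq_add p C' C]
    exact add_nonpos (h n hn x hx Q hQ)
      (mul_nonpos_of_nonneg_of_nonpos hpos.le (D.negSum_nonpos p x Q))
  · rw [D.distortedSum_eq_add p C' C] at h0
    have h1 := h n hn x hx Q hQ
    have h2 := D.negSum_nonpos p x Q
    refine eq_zero_of_negSum_eq_zero hx hQ (p := p) (D := D) (le_antisymm h2 ?_)
    by_contra! hlt
    linarith [mul_neg_of_pos_of_neg hpos hlt]

/-- Each nonzero rank-one piece of `Q` contributes a strictly negative amount, so nothing can
cancel. -/
theorem HasNegativeType.strictDistorted_one {q : ℝ} (h : D.HasNegativeType q) (hp : 0 ≤ p)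
    (hpq : p < q) : D.HasStrictDistortedNegativeType p 1 := by
  have key : ∀ n : ℕ, 2 ≤ n → ∀ x : Fin n → X, Function.Injective x → ∀ Q ∈ nullPSD n,
      D.distortedSum p 1 x Q ≤ 0 ∧ (D.distortedSum p 1 x Q = 0 → Q = 0) := by
    intro n hn x hx Q hQ
    obtain ⟨m, v, hv⟩ := hQ.1.exists_sum_mul
    have hv0 := sum_eq_zero_of_sum_mul hv (mem_nullPSD_iff.1 hQ).2.2
    rw [distortedSum_one, sum_mul_eq_of_sum_mul hv fun i j => (D.pow p).d (x i) (x j)]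
    have hterm : ∀ k, ∑ i, ∑ j, (D.pow p).d (x i) (x j) * v k i * v k j ≤ 0 := fun k => by
      by_cases hk : v k = 0
      · simp [hk]
      · exact (h.sum_neg_of_lt hp hpq hn hx (hv0 k) hk).le
    refine ⟨Finset.sum_nonpos fun k _ => hterm k, fun h0 => ?_⟩
    have hvz : ∀ k, v k = 0 := fun k => by
      by_contra hk
      exact (h.sum_neg_of_lt hp hpq hn hx (hv0 k) hk).ne
        ((Finset.sum_eq_zero_iff_of_nonpos fun k _ => hterm k).1 h0 k (Finset.mem_univ k))
    ext i j
    simp [hv, hvz]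
  exact ⟨fun n hn x hx Q hQ => (key n hn x hx Q hQ).1,
    fun n hn x hx Q hQ => (key n hn x hx Q hQ).2⟩

/-! ### From embeddings to distorted negative type -/

/-- A piece `v k` contributes `-2 ‖∑ i, v k i • g i‖²`. -/
theorem sum_dist_sq_mul_nonpos {E : Type*} [NormedAddCommGroup E] [InnerProductSpace ℝ E]
    {Q : Matrix (Fin n) (Fin n) ℝ} (hQ : Q ∈ nullPSD n) (g : Fin n → E) :
    ∑ i, ∑ j, dist (g i) (g j) ^ 2 * Q i j ≤ 0 := by
  obtain ⟨m, v, hv⟩ := hQ.1.exists_sum_mul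
  have hv0 := sum_eq_zero_of_sum_mul hv (mem_nullPSD_iff.1 hQ).2.2
  rw [sum_mul_eq_of_sum_mul hv fun i j => dist (g i) (g j) ^ 2]
  refine Finset.sum_nonpos fun k _ => ?_
  have h1 := inner_sum_smul_sum_smul_of_sum_eq_zero g (hv0 k) g (hv0 k)
  have h2 := real_inner_self_nonneg (F := E) (x := ∑ i, v k i • g i)
  have e : ∑ i, ∑ j, dist (g i) (g j) ^ 2 * v k i * v k j =
      ∑ i, ∑ j, v k i * v k j * (‖g i - g j‖ * ‖g i - g j‖) :=
    Finset.sum_congr rfl fun i _ => Finset.sum_congr rfl fun j _ => by rw [dist_eq_norm]; ring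
  rw [e]
  linarith

/-- The lower Lipschitz bound serves the positive entries of `Q`, the upper one the negative
entries. -/
theorem HasDistortionAtMost.hasDistortedNegativeType {E : Type*} [NormedAddCommGroup E]
    [InnerProductSpace ℝ E] {f : X → E}
    (h : HasDistortionAtMost (D.pow (p / 2)) (ofMetric E) f C) :
    D.HasDistortedNegativeType p C := by
  intro n _ x _ Q hQ
  obtain ⟨s, hs, hf⟩ := h
  have h1 : ∀ a b, s ^ 2 * (D.pow p).d a b ≤ dist (f a) (f b) ^ 2 := fun a b => by
    rw [← pow_half_d_sq, ← mul_pow]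
    exact pow_le_pow_left₀ (mul_nonneg hs.le ((D.pow _).nonneg a b)) (hf a b).1 2
  have h2 : ∀ a b, dist (f a) (f b) ^ 2 ≤ s ^ 2 * (C ^ 2 * (D.pow p).d a b) := fun a b => by
    rw [← pow_half_d_sq, ← mul_pow, ← mul_pow, ← mul_assoc]
    exact pow_le_pow_left₀ dist_nonneg (hf a b).2 2
  refine nonpos_of_mul_nonpos_right (a := s ^ 2) ?_ (by positivity)
  refine le_trans ?_ (sum_dist_sq_mul_nonpos hQ fun i => f (x i))
  rw [distortedSum]
  simp only [Finset.mul_sum, ← Finset.sum_add_distrib]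
  refine Finset.sum_le_sum fun i _ => Finset.sum_le_sum fun j _ => ?_
  rcases lt_trichotomy (Q i j) 0 with h | h | h
  · simp only [h, h.not_gt, if_true, if_false]
    nlinarith [h2 (x i) (x j)]
  · simp [h]
  · simp only [h, h.not_gt, if_true, if_false]
    nlinarith [h1 (x i) (x j)]

end SemiMetric

/-! ### Duality: from distorted negative type to embeddings -/

namespace Matrix

variable {ι : Type*} [Fintype ι]

theorem convex_condNegDef : Convex ℝ {M : ι → ι → ℝ | (of M).CondNegDef} :=
  fun _ hM _ hN _ _ ha hb _ => (CondNegDef.smul hM ha).add (CondNegDef.smul hN hb)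

theorem strongDual_eq_sum [DecidableEq ι] (f : StrongDual ℝ (ι → ι → ℝ)) (M : ι → ι → ℝ) :
    f M = ∑ i, ∑ j, M i j * f (Pi.single i (Pi.single j 1)) := by
  have e : M = ∑ i, ∑ j, M i j • (Pi.single i (Pi.single j 1) : ι → ι → ℝ) := by
    ext a b
    simp only [Finset.sum_apply, Pi.smul_apply, Pi.single_apply, smul_eq_mul, apply_ite,
      ite_apply, Pi.zero_apply, mul_one, mul_zero]
    simp [Finset.sum_ite_irrel]
  conv_lhs => rw [e]
  simp only [map_sum, map_smul, smul_eq_mul]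

/-- On symmetric matrices with zero diagonal every linear functional is the pairing with a
symmetric matrix whose rows sum to zero. -/
theorem exists_strongDual_eq_sum (f : StrongDual ℝ (ι → ι → ℝ)) :
    ∃ Q : Matrix ι ι ℝ, (∀ i j, Q i j = Q j i) ∧ (∀ i, ∑ j, Q i j = 0) ∧
      ∀ M : ι → ι → ℝ, (∀ i j, M i j = M j i) → (∀ i, M i i = 0) →
        f M = ∑ i, ∑ j, M i j * Q i j := by
  classical
  set c : ι → ι → ℝ := fun i j => f (Pi.single i (Pi.single j 1)) with hc
  set q : ι → ι → ℝ := fun i j => (c i j + c j i) / 2 with hq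
  -- Symmetrise the coefficients, then adjust the diagonal, which `M` does not see, to make the row
  -- sums zero.
  refine ⟨of fun i j => q i j - if i = j then ∑ k, q i k else 0, fun i j => ?_, fun i => ?_,
    fun M hs hd => ?_⟩
  · simp only [of_apply, hq, eq_comm (a := j)]
    split_ifs with h
    · rw [h]
    · ring
  · simp
  · have h1 : ∑ i, ∑ j, M i j * c j i = ∑ i, ∑ j, M i j * c i j := by
      rw [Finset.sum_comm]
      exact Finset.sum_congr rfl fun i _ => Finset.sum_congr rfl fun j _ => by rw [hs]
    have h2 : ∑ i, ∑ j, M i j * (of fun i j => q i j - if i = j then ∑ k, q i k else 0 :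
        Matrix ι ι ℝ) i j = (∑ i, ∑ j, M i j * c i j + ∑ i, ∑ j, M i j * c j i) / 2 := by
      simp only [← Finset.sum_add_distrib, Finset.sum_div]
      refine Finset.sum_congr rfl fun i _ => ?_
      simp only [of_apply, mul_sub, Finset.sum_sub_distrib, mul_ite, mul_zero, Finset.sum_ite_eq,
        Finset.mem_univ, if_true, hd, zero_mul, sub_zero]
      exact Finset.sum_congr rfl fun j _ => by rw [hq]; ring
    rw [h2, h1, strongDual_eq_sum]
    ring

end Matrix

namespace SemiMetric

open Matrix Filter Topology

variable {X : Type*} {D : SemiMetric X} {p C : ℝ} {n : ℕ}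

/-- The duality behind the characterisation of the Euclidean distortion: if all distorted sums are
nonpositive, then some matrix of squared Euclidean distances lies between `d ^ p` and
`C ^ 2 * d ^ p`. -/
theorem exists_condNegDef_between (hC : 1 ≤ C) (x : Fin n → X)
    (h : ∀ Q ∈ nullPSD n, D.distortedSum p C x Q ≤ 0) :
    ∃ M : Fin n → Fin n → ℝ, (of M).CondNegDef ∧
      ∀ i j, (D.pow p).d (x i) (x j) ≤ M i j ∧ M i j ≤ C ^ 2 * (D.pow p).d (x i) (x j) := by
  set W : Fin n → Fin n → ℝ := fun i j => (D.pow p).d (x i) (x j) with hW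
  have hWle : ∀ i j, W i j ≤ C ^ 2 * W i j := fun i j =>
    le_mul_of_one_le_left ((D.pow p).nonneg _ _) (one_le_pow₀ hC)
  by_contra! hcon
  have hdisj : Disjoint {M : Fin n → Fin n → ℝ | (of M).CondNegDef} (Set.Icc W (C ^ 2 • W)) := by
    refine Set.disjoint_left.2 fun M hM hB => ?_
    obtain ⟨i, j, hij⟩ := hcon M hM
    exact (hij (hB.1 i j)).not_ge (hB.2 i j)
  -- Separate the closed cone of squared distances from the compact box `[W, C² W]`.
  obtain ⟨f, u, v, hfu, huv, hfv⟩ := geometric_hahn_banach_closed_compact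
    convex_condNegDef isClosed_condNegDef (convex_Icc W (C ^ 2 • W)) isCompact_Icc hdisj
  have hzero : (of (0 : Fin n → Fin n → ℝ)).CondNegDef := by
    constructor <;> simp
  have hu : 0 < u := by simpa using hfu 0 hzero
  -- A functional bounded above on a cone is nonpositive there: otherwise rescaling reaches the
  -- value `u`.
  have hfA : ∀ M : Fin n → Fin n → ℝ, (of M).CondNegDef → f M ≤ 0 := fun M hM => by
    by_contra! hpos
    have := hfu ((u / f M) • M) (CondNegDef.smul hM (by positivity))
    rw [map_smul, smul_eq_mul, div_mul_cancel₀ _ hpos.ne'] at this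
    exact lt_irrefl _ this
  obtain ⟨Q, hQs, hQ0, hfQ⟩ := exists_strongDual_eq_sum f
  have hQ : Q ∈ nullPSD n := by
    refine mem_nullPSD_iff.2 ⟨hQs, fun ξ => ?_, hQ0⟩
    have hc := condNegDef_sq_sub ξ
    have := hfA (fun i j => (ξ i - ξ j) ^ 2) hc
    rw [hfQ (fun i j => (ξ i - ξ j) ^ 2) hc.symm hc.diag, sum_mul_sq_sub hQs hQ0] at this
    linarith
  -- This vertex of the box minimises the pairing with `Q`, and the minimum is the distorted sum.
  have hM := hfv (fun i j => if Q i j < 0 then C ^ 2 * W i j else W i j) ⟨fun i j => ?_,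
    fun i j => ?_⟩
  · rw [hfQ _ (fun i j => by simp only [hQs i j, hW, (D.pow p).symm (x i)])
      fun i => by simp [hW, d_self]] at hM
    have e : ∑ i, ∑ j, (if Q i j < 0 then C ^ 2 * W i j else W i j) * Q i j =
        D.distortedSum p C x Q := by
      rw [distortedSum]
      simp only [Finset.mul_sum, ← Finset.sum_add_distrib]
      refine Finset.sum_congr rfl fun i _ => Finset.sum_congr rfl fun j _ => ?_
      rcases lt_trichotomy (Q i j) 0 with h | h | h
      · simp [h, h.not_gt, hW, mul_assoc]
      · simp [h]
      · simp [h, h.not_gt, hW]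
    rw [e] at hM
    linarith [h Q hQ]
  · dsimp only
    split_ifs
    · exact hWle i j
    · exact le_rfl
  · dsimp only [Pi.smul_apply, smul_eq_mul]
    split_ifs
    · exact le_rfl
    · exact hWle i j

theorem exists_hasDistortionAtMost (hC : 1 ≤ C) {x : Fin n → X} (hx : Function.Bijective x)
    (h : ∀ Q ∈ nullPSD n, D.distortedSum p C x Q ≤ 0) :
    ∃ f : X → lp (fun _ : ℕ => ℝ) 2,
      HasDistortionAtMost (D.pow (p / 2)) (ofMetric (lp (fun _ : ℕ => ℝ) 2)) f C := by
  obtain ⟨M, hM, hWM⟩ := exists_condNegDef_between hC x h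
  obtain ⟨g, hg⟩ := hM.exists_lp
  let e := Equiv.ofBijective x hx
  refine ⟨fun a => g (e.symm a), 1, one_pos, fun a b => ?_⟩
  have ha : x (e.symm a) = a := e.apply_symm_apply a
  have hb : x (e.symm b) = b := e.apply_symm_apply b
  have := hWM (e.symm a) (e.symm b)
  rw [ha, hb, ← pow_half_d_sq, ← mul_pow] at this
  change 1 * _ ≤ dist _ _ ∧ dist _ _ ≤ 1 * C * _
  rw [one_mul, one_mul]
  have h2 := hg (e.symm a) (e.symm b)
  rw [of_apply] at h2
  rw [← h2] at this
  exact ⟨le_of_sq_le_sq this.1 dist_nonneg, le_of_sq_le_sq this.2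
    (mul_nonneg (by linarith) ((D.pow _).nonneg a b))⟩

/-! ### Unfolding the extremal constants; openness by compactness -/

theorem euclideanDistortion_lt_iff {C : ℝ} : D.euclideanDistortion < (C : EReal) ↔
    ∃ C' : ℝ, 1 ≤ C' ∧ C' < C ∧ ∃ f : X → lp (fun _ : ℕ => ℝ) 2,
      HasDistortionAtMost D (ofMetric (lp (fun _ : ℕ => ℝ) 2)) f C' := by
  rw [euclideanDistortion, leastDistortion, sInf_lt_iff]
  constructor
  · rintro ⟨C₁, ⟨-, f, hf⟩, hlt⟩
    obtain ⟨_, ⟨C', ⟨h1, h2⟩, rfl⟩, h3⟩ := sInf_lt_iff.1 (hf.trans_lt hlt)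
    exact ⟨C', h1, EReal.coe_lt_coe_iff.1 h3, f, h2⟩
  · rintro ⟨C', h1, h2, f, hf⟩
    exact ⟨C', ⟨by exact_mod_cast h1, f, sInf_le ⟨C', ⟨h1, hf⟩, rfl⟩⟩,
      EReal.coe_lt_coe_iff.2 h2⟩

theorem lt_supremalNegativeType_iff (hp : 0 ≤ p) : (p : EReal) < D.supremalNegativeType ↔
    ∃ q : ℝ, p < q ∧ D.HasNegativeType q := by
  rw [supremalNegativeType, lt_sSup_iff]
  constructor
  · rintro ⟨_, ⟨q, ⟨-, hq⟩, rfl⟩, h⟩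
    exact ⟨q, EReal.coe_lt_coe_iff.1 h, hq⟩
  · rintro ⟨q, h, hq⟩
    exact ⟨q, ⟨q, ⟨hp.trans h.le, hq⟩, rfl⟩, EReal.coe_lt_coe_iff.2 h⟩

/-- To have negative type it suffices to check one enumeration of the space. -/
theorem hasNegativeType_of_bijective {x : Fin n → X} (hx : Function.Bijective x)
    (h : ∀ ξ : Fin n → ℝ, ∑ i, ξ i = 0 →
      ∑ i, ∑ j, (D.pow p).d (x i) (x j) * ξ i * ξ j ≤ 0) : D.HasNegativeType p := by
  classical
  intro m _ y _ ξ hξ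
  let e := Equiv.ofBijective x hx
  have he : ∀ a, x (e.symm a) = a := e.apply_symm_apply
  -- Push the weights `ξ` forward along `y` to the full enumeration.
  have key := h (fun i => ∑ k, if e.symm (y k) = i then ξ k else 0) (by
    rw [Finset.sum_comm]
    simpa using hξ)
  convert key using 1
  have h1 : ∀ F : Fin n → ℝ, ∑ i, F i * (∑ k, if e.symm (y k) = i then ξ k else 0) =
      ∑ k, F (e.symm (y k)) * ξ k := fun F => by
    simp only [Finset.mul_sum]
    rw [Finset.sum_comm]
    simp
  have h2 : ∀ i, ∑ j, (D.pow p).d (x i) (x j) * (∑ k, if e.symm (y k) = i then ξ k else 0) *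
      (∑ k, if e.symm (y k) = j then ξ k else 0) =
      (∑ l, (D.pow p).d (x i) (y l) * ξ l) * (∑ k, if e.symm (y k) = i then ξ k else 0) :=
    fun i => by
      rw [h1 fun j => (D.pow p).d (x i) (x j) * ∑ k, if e.symm (y k) = i then ξ k else 0,
        Finset.sum_mul]
      exact Finset.sum_congr rfl fun l _ => by rw [he]; ring
  simp only [h2]
  rw [h1 fun i => ∑ l, (D.pow p).d (x i) (y l) * ξ l]
  refine Finset.sum_congr rfl fun k _ => ?_
  rw [he, Finset.sum_mul]
  exact Finset.sum_congr rfl fun l _ => by ring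

/-- The form is jointly continuous in exponent and vector, so negativity on the compact unit sphere
of the zero-sum hyperplane persists for nearby exponents; homogeneity does the rest. -/
theorem exists_hasNegativeType_gt {x : Fin n → X} (hx : Function.Bijective x)
    (h : ∀ ξ : Fin n → ℝ, ∑ i, ξ i = 0 → ξ ≠ 0 →
      ∑ i, ∑ j, (D.pow p).d (x i) (x j) * ξ i * ξ j < 0) :
    ∃ q, p < q ∧ D.HasNegativeType q := by
  set K : Set (Fin n → ℝ) := Metric.sphere 0 1 ∩ {ξ | ∑ i, ξ i = 0}
  have hK : IsCompact K := (isCompact_sphere 0 1).inter_right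
    (isClosed_eq (by fun_prop) continuous_const)
  have hcont : Continuous fun z : ℝ × (Fin n → ℝ) =>
      ∑ i, ∑ j, (D.pow z.1).d (x i) (x j) * z.2 i * z.2 j := by
    refine continuous_finsetSum _ fun i _ => continuous_finsetSum _ fun j _ => ?_
    have := (D.continuous_pow_d (x i) (x j)).comp (continuous_fst (X := ℝ) (Y := Fin n → ℝ))
    exact (this.mul (by fun_prop)).mul (by fun_prop)
  have hev : ∀ᶠ q in 𝓝 p, ∀ ξ ∈ K, ∑ i, ∑ j, (D.pow q).d (x i) (x j) * ξ i * ξ j < 0 := by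
    refine hK.eventually_forall_of_forall_eventually fun ξ hξ => ?_
    have hne : ξ ≠ 0 := by
      rintro rfl
      simpa using hξ.1
    exact (hcont.tendsto (p, ξ)).eventually_lt_const (h ξ hξ.2 hne)
  obtain ⟨q, hq, hpq⟩ := ((hev.filter_mono nhdsWithin_le_nhds).and
    (self_mem_nhdsWithin : Set.Ioi p ∈ 𝓝[>] p)).exists
  refine ⟨q, hpq, hasNegativeType_of_bijective hx fun ξ hξ => ?_⟩
  rcases eq_or_ne ξ 0 with rfl | hne
  · simp
  have hn := norm_pos_iff.2 hne
  have h1 := hq (‖ξ‖⁻¹ • ξ) ⟨by simp [norm_smul, hn.ne'], by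
    simp [← Finset.mul_sum, hξ]⟩
  have e : ∑ i, ∑ j, (D.pow q).d (x i) (x j) * (‖ξ‖⁻¹ • ξ) i * (‖ξ‖⁻¹ • ξ) j =
      (‖ξ‖⁻¹ * ‖ξ‖⁻¹) * ∑ i, ∑ j, (D.pow q).d (x i) (x j) * ξ i * ξ j := by
    simp only [Finset.mul_sum, Pi.smul_apply, smul_eq_mul]
    exact Finset.sum_congr rfl fun i _ => Finset.sum_congr rfl fun j _ => by ring
  rw [e] at h1
  exact (neg_of_mul_neg_right h1 (by positivity)).le

/-- Without case distinctions, joint continuity in `C` and `Q` is visible. -/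
theorem distortedSum_eq_max_min (D : SemiMetric X) (p C : ℝ) (x : Fin n → X)
    (Q : Matrix (Fin n) (Fin n) ℝ) :
    D.distortedSum p C x Q = ∑ i, ∑ j, (D.pow p).d (x i) (x j) * max (Q i j) 0 +
      C ^ 2 * ∑ i, ∑ j, (D.pow p).d (x i) (x j) * min (Q i j) 0 := by
  rw [distortedSum]
  refine congrArg₂ (fun a b : ℝ => a + C ^ 2 * b) ?_ ?_
  · refine Finset.sum_congr rfl fun i _ => Finset.sum_congr rfl fun j _ => ?_
    split_ifs with h
    · rw [max_eq_left h.le]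
    · rw [max_eq_right (not_lt.1 h), mul_zero]
  · refine Finset.sum_congr rfl fun i _ => Finset.sum_congr rfl fun j _ => ?_
    split_ifs with h
    · rw [min_eq_left h.le]
    · rw [min_eq_right (not_lt.1 h), mul_zero]

theorem distortedSum_smul (D : SemiMetric X) (p C : ℝ) (x : Fin n → X)
    (Q : Matrix (Fin n) (Fin n) ℝ) {a : ℝ} (ha : 0 < a) :
    D.distortedSum p C x (a • Q) = a * D.distortedSum p C x Q := by
  have hneg : ∀ b : ℝ, a * b < 0 ↔ b < 0 := fun b => by
    rw [← neg_pos, ← mul_neg, mul_pos_iff_of_pos_left ha, neg_pos]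
  simp only [distortedSum, Matrix.smul_apply, smul_eq_mul, mul_pos_iff_of_pos_left ha, hneg,
    mul_add, Finset.mul_sum, mul_ite, mul_zero, mul_left_comm _ a]

theorem isClosed_nullPSD : IsClosed {Q : Fin n → Fin n → ℝ | of Q ∈ nullPSD n} := by
  have e : {Q : Fin n → Fin n → ℝ | of Q ∈ nullPSD n} =
      (⋂ i, ⋂ j, {Q | Q i j = Q j i}) ∩
        ((⋂ ξ : Fin n → ℝ, {Q | 0 ≤ ∑ i, ∑ j, Q i j * ξ i * ξ j}) ∩
          ⋂ i, {Q | ∑ j, Q i j = 0}) := by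
    ext Q
    simp only [Set.mem_inter_iff, Set.mem_iInter]
    exact mem_nullPSD_iff
  rw [e]
  refine (isClosed_iInter fun i => isClosed_iInter fun j => isClosed_eq ?_ ?_).inter
    ((isClosed_iInter fun ξ => isClosed_le ?_ ?_).inter
      (isClosed_iInter fun i => isClosed_eq ?_ ?_)) <;> fun_prop

theorem smul_mem_nullPSD {Q : Matrix (Fin n) (Fin n) ℝ} (hQ : Q ∈ nullPSD n) {a : ℝ}
    (ha : 0 ≤ a) : a • Q ∈ nullPSD n :=
  ⟨hQ.1.smul ha, by rw [smul_mulVec, hQ.2, smul_zero]⟩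

/-- Strictness leaves room to decrease the distortion. -/
theorem exists_distortion_lt (hC : 1 < C) (x : Fin n → X)
    (h : ∀ Q ∈ nullPSD n, Q ≠ 0 → D.distortedSum p C x Q < 0) :
    ∃ C', 1 ≤ C' ∧ C' < C ∧ ∀ Q ∈ nullPSD n, D.distortedSum p C' x Q ≤ 0 := by
  set K : Set (Fin n → Fin n → ℝ) := Metric.sphere 0 1 ∩ {Q | of Q ∈ nullPSD n}
  have hK : IsCompact K := (isCompact_sphere 0 1).inter_right isClosed_nullPSD
  have hcont : Continuous fun z : ℝ × (Fin n → Fin n → ℝ) =>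
      D.distortedSum p z.1 x (of z.2) := by
    simp only [distortedSum_eq_max_min, of_apply]
    fun_prop
  have hev : ∀ᶠ C' in 𝓝 C, ∀ Q ∈ K, D.distortedSum p C' x (of Q) < 0 := by
    refine hK.eventually_forall_of_forall_eventually fun Q hQ => ?_
    have hne : Q ≠ 0 := by
      rintro rfl
      simpa using hQ.1
    exact (hcont.tendsto (C, Q)).eventually_lt_const (h (of Q) hQ.2 hne)
  obtain ⟨C', ⟨hq, h1⟩, hlt⟩ := (((hev.and (lt_mem_nhds hC)).filter_mono nhdsWithin_le_nhds).and
    (self_mem_nhdsWithin : Set.Iio C ∈ 𝓝[<] C)).exists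
  refine ⟨C', h1.le, hlt, fun Q hQ => ?_⟩
  rcases eq_or_ne Q 0 with rfl | hne
  · simp [distortedSum]
  let R : Fin n → Fin n → ℝ := Q
  have hn : 0 < ‖R‖ := norm_pos_iff.2 hne
  have h2 := hq (‖R‖⁻¹ • R) ⟨by simp [norm_smul, hn.ne'],
    smul_mem_nullPSD hQ (inv_nonneg.2 hn.le)⟩
  have h3 := D.distortedSum_smul p C' x Q (inv_pos.2 hn)
  change D.distortedSum p C' x (‖R‖⁻¹ • Q) < 0 at h2
  rw [h3] at h2
  exact (neg_of_mul_neg_right h2 (inv_nonneg.2 hn.le)).le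

theorem HasStrictDistortedNegativeType.distortedSum_neg
    (h : D.HasStrictDistortedNegativeType p C) (hn : 2 ≤ n) {x : Fin n → X}
    (hx : Function.Injective x) {Q : Matrix (Fin n) (Fin n) ℝ} (hQ : Q ∈ nullPSD n)
    (hne : Q ≠ 0) : D.distortedSum p C x Q < 0 :=
  lt_of_le_of_ne (h.1 n hn x hx Q hQ) fun e => hne (h.2 n hn x hx Q hQ e)

/-- Test on the rank-one matrix `ξ ξᵀ`, whose diagonal detects `ξ ≠ 0`. -/
theorem HasStrictDistortedNegativeType.sum_neg (h : D.HasStrictDistortedNegativeType p 1)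
    (hn : 2 ≤ n) {x : Fin n → X} (hx : Function.Injective x) {ξ : Fin n → ℝ}
    (hξ : ∑ i, ξ i = 0) (hne : ξ ≠ 0) :
    ∑ i, ∑ j, (D.pow p).d (x i) (x j) * ξ i * ξ j < 0 := by
  have h1 := h.distortedSum_neg hn hx (vecMulVec_mem_nullPSD hξ) fun h0 => hne <| funext fun i =>
    mul_self_eq_zero.1 (congrFun (congrFun h0 i) i)
  rw [distortedSum_one] at h1
  simpa only [vecMulVec_apply, mul_assoc] using h1

end SemiMetric

/-! ### The characterisation -/

open SemiMetric in
theorem corollary3p8 {X : Type*} [Finite X] (D : SemiMetric X) (p C : ℝ)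
    (hp : 0 ≤ p) (hC : 1 ≤ C) :
    D.HasStrictDistortedNegativeType p C ↔
      (p : EReal) < D.supremalNegativeType ∨
        (D.pow (p / 2)).euclideanDistortion < (C : EReal) := by
  rw [lt_supremalNegativeType_iff hp, euclideanDistortion_lt_iff]
  constructor
  · intro h
    obtain ⟨n, ⟨e⟩⟩ := Finite.exists_equiv_fin X
    have hx : Function.Bijective e.symm := e.symm.bijective
    -- With fewer than two points, every exponent is vacuously of negative type.
    rcases lt_or_ge n 2 with hn | hn
    · refine Or.inl ⟨p + 1, lt_add_one p, fun m hm y hy => ?_⟩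
      have := Fintype.card_le_of_injective _ (e.injective.comp hy)
      simp only [Fintype.card_fin] at this
      omega
    rcases hC.eq_or_lt with rfl | hC1
    · exact Or.inl (exists_hasNegativeType_gt hx fun ξ => h.sum_neg hn hx.1)
    · obtain ⟨C', h1, h2, h3⟩ := exists_distortion_lt hC1 e.symm fun Q => h.distortedSum_neg hn hx.1
      exact Or.inr ⟨C', h1, h2, exists_hasDistortionAtMost h1 hx h3⟩
  · rintro (⟨q, hpq, hq⟩ | ⟨C', h1, h2, f, hf⟩)
    · exact (hq.strictDistorted_one hp hpq).mono zero_le_one hC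
    · exact hf.hasDistortedNegativeType.strict_of_lt (zero_le_one.trans h1) h2
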